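/- Throughout, $N\ge 1$, $[N]^3$ is the grid, a set is identified with its indicator function, $\log$ is to base $2$, and $a=b(1\pm\gamma)$ (with $b\ge 0$) means $|a-b|\le\gamma b$. A \emph{cube} is a set $C=X\times Y\times Z$ with $X,Y,Z\subseteq[N]$. Let $\gamma>0$ and let $D\subseteq[N]^3$ have density $\mu=|D|/N^3$. The set $D$ is \emph{$\gamma$-pseudorandom with respect to large cubes} if for every cube $C=X\times Y\times Z$ with $|C|\ge\gamma N^3$ one has $$\mathbb E_{(x,y,z)\in X\times Y\times Z}[D(x,y,z)]=\mu(1\pm\gamma),\qquad \mathbb E_{(x,y,z,z')\in X\times Y\times Z\times Z}[D(x,y,z)D(x,y,z')]=\mu^2(1\pm\gamma),$$ together with the analogous second conditions $\mathbb E[D(x,y,z)D(x',y,z)]=\mu^2(1\pm\gamma)$ over $X\times X\times Y\times Z$ and $\mathbb E[D(x,y,z)D(x,y',z)]=\mu^2(1\pm\gamma)$ over $X\times Y\times Y\times Z$. A \emph{cylinder intersection} is a set of the form $\{(x,y,z)\in[N]^3:(x,y)\in S_1,\ (x,z)\in S_2,\ (y,z)\in S_3\}$ with $S_1,S_2,S_3\subseteq[N]^2$.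 For $T\subseteq[N]^3$ the \emph{cylinder intersection closure} $\overline{CI}(T)$ is the smallest cylinder intersection containing $T$, namely the set of all $(x,y,z)$ such that $(x,y,z'),(x,y',z),(x',y,z)\in T$ for some $x',y',z'\in[N]$. \textbf{Theorem.} The following two (equivalent) statements hold. (i) There are absolute constants $c>0$ and $t_0>0$ such that, for every $N$, every $\gamma>0$, every nonempty $D\subseteq[N]^3$ that is $\gamma$-pseudorandom with respect to large cubes, every real $t$ with $t_0\le t\le\log(1/\gamma)$, and every cylinder intersection $F\subseteq[N]^3$ of density $|F|/N^3\le 2^{-t}$, $$\mathbb E_{(x,y,z)\in D}[F(x,y,z)]=\frac{|F\cap D|}{|D|}\le 2^{-c\,t^{1/3}}.$$ (ii) There are absolute constants $C_1,C_2>0$ such that, for every $N$, every $\gamma>0$, every nonempty $D\subseteq[N]^3$ that is $\gamma$-pseudorandom with respect to large cubes, every real $d\ge 1$ with $\gamma\le 2^{-C_1d^3}$, and every $T\subseteq D$ with $|T|\ge 2^{-d}|D|$, $$|\overline{CI}(T)|\ge 2^{-C_2d^3}N^3.$$ -/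

import Mathlib

open scoped BigOperators

namespace NOF

/-- The grid `[N]³`. -/
abbrev Grid (N : ℕ) : Type := Fin N × Fin N × Fin N

/-- The indicator function of a set `D ⊆ [N]³`, with real values. -/
def ind {N : ℕ} (D : Finset (Grid N)) (p : Grid N) : ℝ := if p ∈ D then 1 else 0

/-- The density `𝔼[D]` of a set `D ⊆ [N]³`. -/
noncomputable def density {N : ℕ} (D : Finset (Grid N)) : ℝ := 𝔼 p : Grid N, ind D p

/-- `D` is `γ`-pseudorandom with respect to the cube `X × Y × Z`. An equation `a = b (1 ± γ)` with
`b ≥ 0` means `|a - b| ≤ γ b`. -/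
structure PseudorandomOn {N : ℕ} (γ : ℝ) (D : Finset (Grid N)) (X Y Z : Finset (Fin N)) :
    Prop where
  dens : |(𝔼 x ∈ X, 𝔼 y ∈ Y, 𝔼 z ∈ Z, ind D (x, y, z)) - density D| ≤ γ * density D
  pairs_z : |(𝔼 x ∈ X, 𝔼 y ∈ Y, 𝔼 z ∈ Z, 𝔼 z' ∈ Z, ind D (x, y, z) * ind D (x, y, z'))
    - density D ^ 2| ≤ γ * density D ^ 2
  pairs_x : |(𝔼 x ∈ X, 𝔼 x' ∈ X, 𝔼 y ∈ Y, 𝔼 z ∈ Z, ind D (x, y, z) * ind D (x', y, z))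
    - density D ^ 2| ≤ γ * density D ^ 2
  pairs_y : |(𝔼 x ∈ X, 𝔼 y ∈ Y, 𝔼 y' ∈ Y, 𝔼 z ∈ Z, ind D (x, y, z) * ind D (x, y', z))
    - density D ^ 2| ≤ γ * density D ^ 2

/-- `D` is `γ`-pseudorandom with respect to large cubes. -/
def PseudorandomLargeCubes {N : ℕ} (γ : ℝ) (D : Finset (Grid N)) : Prop :=
  ∀ X Y Z : Finset (Fin N), γ * (N : ℝ) ^ 3 ≤ ((X ×ˢ Y ×ˢ Z).card : ℝ) → PseudorandomOn γ D X Y Z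

/-- The set `CI(S₁, S₂, S₃)`. -/
def CI {N : ℕ} (S₁ S₂ S₃ : Finset (Fin N × Fin N)) : Finset (Grid N) :=
  Finset.univ.filter fun p => (p.1, p.2.1) ∈ S₁ ∧ (p.1, p.2.2) ∈ S₂ ∧ (p.2.1, p.2.2) ∈ S₃

/-- `F ⊆ [N]³` is a cylinder intersection. -/
def IsCylinderIntersection {N : ℕ} (F : Finset (Grid N)) : Prop :=
  ∃ S₁ S₂ S₃ : Finset (Fin N × Fin N), F = CI S₁ S₂ S₃

/-- The cylinder intersection closure of `T`, built from the three marginals of `T`. -/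
def ciClosure {N : ℕ} (T : Finset (Grid N)) : Finset (Grid N) :=
  CI (T.image fun p => (p.1, p.2.1)) (T.image fun p => (p.1, p.2.2))
    (T.image fun p => (p.2.1, p.2.2))

/-- The closure is the smallest cylinder intersection that contains `T`. -/
theorem ciClosure_isLeast {N : ℕ} (T : Finset (Grid N)) :
    IsLeast {F : Finset (Grid N) | IsCylinderIntersection F ∧ T ⊆ F} (ciClosure T) := by
  refine ⟨⟨⟨_, _, _, rfl⟩, ?_⟩, ?_⟩
  · intro p hp
    simp only [ciClosure, CI, Finset.mem_filter, Finset.mem_univ, true_and]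
    exact ⟨Finset.mem_image_of_mem _ hp, Finset.mem_image_of_mem (fun p : Grid N => (p.1, p.2.2)) hp,
      Finset.mem_image_of_mem (fun p : Grid N => (p.2.1, p.2.2)) hp⟩
  · rintro F ⟨⟨S₁, S₂, S₃, rfl⟩, hT⟩ p hp
    simp only [ciClosure, CI, Finset.mem_filter, Finset.mem_univ, true_and, Finset.mem_image] at hp
    obtain ⟨⟨a, ha, ha'⟩, ⟨b, hb, hb'⟩, ⟨e, he, he'⟩⟩ := hp
    have h1 := hT ha
    have h2 := hT hb
    have h3 := hT he
    simp only [CI, Finset.mem_filter, Finset.mem_univ, true_and] at h1 h2 h3 ⊢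
    exact ⟨ha' ▸ h1.1, hb' ▸ h2.2.1, he' ▸ h3.2.2⟩

end NOF

/-!
Both parts follow from one bound: if `T ⊆ D` has relative density `2 ^ (-d)` and a cylinder
intersection `F` contains `T`, then `|F| ≥ 2 ^ (-O(d ^ 3)) N ^ 3`. The first part is the
contrapositive applied to `T = F ∩ D`, the second is the case `F = ciClosure T`.

Let `τ(Q)` be the number of points of `T` in a cube `Q`, divided by `μ |Q|`, where `μ` is the density
of `D`. Pseudorandomness keeps `τ` below `2` on large cubes. Maximizing `τ(Q) ^ m |Q|` with `m` of
order `d ^ 2` gives a cube `Q = X × Y × Z` of density `2 ^ (-O(d ^ 3))` on which `τ` is stable: no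
subcube with at least a fraction `2 ^ (-O(d ^ 2))` of the points of `Q` has a noticeably larger `τ`
(`exists_stable_cube`). This one choice replaces an iterated density increment.

On `Q` consider the three marginals `a(x, y) = 𝔼 z, T(x, y, z) / μ`, `b(x, z)` and `c(y, z)`,
truncated at `1`. By the second-moment conditions on `D` the fibres of `D` have nearly constant size,
so truncation costs almost nothing and all three have mean `δ ≈ τ(Q)` (`sub_le_expect_min`). A
rectangle on which a marginal is denser than `(1 + ε) δ` would be a subcube with larger `τ`, so the
marginals have no such rectangles (`noDenseRect_min`). As `a * b * c` is at most the indicator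
function of `F`, it remains to bound the triangle count `𝔼 a(x, y) b(x, z) c(y, z)` from below by
`δ ^ 3 / 4` (`triangle_lower_bound`).

If this failed, then `a` would correlate negatively with the kernel `⟨b - δ, c - δ⟩`, after discarding
the few rows of low degree, so this kernel would have a `p`-th moment of at least
`(δ ^ 2 / 8) ^ p` for an even `p` of order `d`. By Cauchy-Schwarz (`corrMoment_sq_le`) the same would
hold for `⟨b - δ, b - δ⟩` or for `⟨c - δ, c - δ⟩`. All moments of such a symmetric kernel are
nonnegative, so in the binomial expansion of the moment of order `17 p + 1` of
`δ ^ 2 + ⟨b - δ, b - δ⟩`, essentially `⟨b, b⟩`, the `p`-th term alone makes the moment exponentially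
larger than `δ ^ (2 (17 p + 1))`. But the absence of dense rectangles bounds the moments of `⟨b, b⟩`
one order at a time (`corrMoment_succ_le`), which gives a contradiction (`corrMoment_balanced_lt`).
-/

namespace NOF

/-! ### Moments of correlation kernels -/

/-- The moment `𝔼 x y, ⟨f x, g y⟩ ^ p`, where `⟨f x, g y⟩ = 𝔼 z, f x z * g y z`. -/
noncomputable def corrMoment {α β ι : Type*} (X : Finset α) (Y : Finset β) (Z : Finset ι)
    (f : α → ι → ℝ) (g : β → ι → ℝ) (p : ℕ) : ℝ :=
  𝔼 x ∈ X, 𝔼 y ∈ Y, (𝔼 z ∈ Z, f x z * g y z) ^ p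

/-- Up to an additive error `η`, no product weight `u ⊗ v` with values in `[0, 1]` gives `f` an
average greater than `K`. -/
def NoDenseRect {α β : Type*} (X : Finset α) (Y : Finset β) (f : α → β → ℝ) (K η : ℝ) : Prop :=
  ∀ (u : α → ℝ) (v : β → ℝ), (∀ x, 0 ≤ u x) → (∀ x, u x ≤ 1) → (∀ y, 0 ≤ v y) → (∀ y, v y ≤ 1) →
    𝔼 x ∈ X, 𝔼 y ∈ Y, u x * f x y * v y ≤ K * (𝔼 x ∈ X, u x) * (𝔼 y ∈ Y, v y) + η

/-- Moving the innermost of three averages to the outside. -/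
theorem expect_rotate {α β ι : Type*} (X : Finset α) (Y : Finset β) (Z : Finset ι)
    (f : α → β → ι → ℝ) :
    𝔼 x ∈ X, 𝔼 y ∈ Y, 𝔼 z ∈ Z, f x y z = 𝔼 z ∈ Z, 𝔼 x ∈ X, 𝔼 y ∈ Y, f x y z := by
  simp only [Finset.expect_comm Y Z, Finset.expect_comm X Z]

section Moments

variable {α β ι : Type*} {X : Finset α} {Y : Finset β} {Z : Finset ι}

/-- Expanding the power exchanges the averages: for a fixed tuple `q` of columns the average
factors, and for `f = g` it is a square. -/
theorem corrMoment_eq (f : α → ι → ℝ) (g : β → ι → ℝ) (p : ℕ) :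
    corrMoment X Y Z f g p = 𝔼 q ∈ Fintype.piFinset fun _ : Fin p => Z,
      (𝔼 x ∈ X, ∏ i, f x (q i)) * 𝔼 y ∈ Y, ∏ i, g y (q i) := by
  simp only [corrMoment, Finset.expect_pow, Finset.expect_mul_expect, ← Finset.prod_mul_distrib]
  exact expect_rotate ..

theorem corrMoment_self_nonneg (f : α → ι → ℝ) (p : ℕ) : 0 ≤ corrMoment X X Z f f p := by
  rw [corrMoment_eq]
  exact Finset.expect_nonneg fun q _ => mul_self_nonneg _

/-- Cauchy-Schwarz decouples the two functions of a correlation kernel. -/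
theorem corrMoment_sq_le (f : α → ι → ℝ) (g : β → ι → ℝ) (p : ℕ) :
    corrMoment X Y Z f g p ^ 2 ≤ corrMoment X X Z f f p * corrMoment Y Y Z g g p := by
  simp only [corrMoment_eq, ← pow_two]
  exact Finset.expect_mul_sq_le_sq_mul_sq _ _ _

/-- A single term of the binomial expansion is a lower bound, as all moments of the kernel `⟨f, f⟩`
are nonnegative. -/
theorem choose_mul_corrMoment_le (f : α → ι → ℝ) {s : ℝ} (hs : 0 ≤ s) {p P : ℕ} (hp : p ≤ P) :
    P.choose p * s ^ (P - p) * corrMoment X X Z f f p ≤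
      𝔼 x ∈ X, 𝔼 x' ∈ X, ((𝔼 z ∈ Z, f x z * f x' z) + s) ^ P := by
  have h : 𝔼 x ∈ X, 𝔼 x' ∈ X, ((𝔼 z ∈ Z, f x z * f x' z) + s) ^ P =
      ∑ j ∈ Finset.range (P + 1), P.choose j * s ^ (P - j) * corrMoment X X Z f f j := by
    simp only [add_pow, Finset.expect_sum_comm, corrMoment, Finset.mul_expect]
    refine Finset.sum_congr rfl fun j _ => Finset.expect_congr rfl fun x _ =>
      Finset.expect_congr rfl fun x' _ => ?_
    ring
  rw [h]
  exact Finset.single_le_sum (f := fun j => (P.choose j : ℝ) * s ^ (P - j) * corrMoment X X Z f f j)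
    (fun j _ => mul_nonneg (by positivity) (corrMoment_self_nonneg f j))
    (Finset.mem_range.2 (Nat.lt_succ_of_le hp))

theorem pow_le_choose_seventeen (p : ℕ) : 16 ^ p ≤ (17 * p + 1).choose p := by
  have h := Nat.pow_le_choose (α := ℝ) p (17 * p + 1)
  have h1 : (17 * p + 1 + 1 - p : ℕ) = 16 * p + 2 := by omega
  rw [h1] at h
  have h2 : (16 : ℝ) ^ p ≤ ((16 * p + 2 : ℕ) : ℝ) ^ p / (p.factorial : ℝ) := by
    rw [le_div_iff₀ (by positivity)]
    calc (16 : ℝ) ^ p * p.factorial ≤ 16 ^ p * p ^ p := by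
          gcongr; exact_mod_cast Nat.factorial_le_pow p
      _ = (16 * p) ^ p := by rw [mul_pow]
      _ ≤ _ := by gcongr; push_cast; linarith
  exact_mod_cast h2.trans h

/-- Expanding only a `j`-th power as an average over `q`, the `(j + 1)`-st moment becomes an average
of `𝔼 z, (𝔼 x, w x * b x z) ^ 2` for the weights `w x = ∏ i, b x (q i)`, and each of the two factors
of the square can be bounded with `NoDenseRect`. -/
theorem corrMoment_succ_le {b : α → ι → ℝ} {K η : ℝ} (h0 : ∀ x z, 0 ≤ b x z)
    (h1 : ∀ x z, b x z ≤ 1) (hK0 : 0 ≤ K) (hK : K ≤ 2) (hη : 0 ≤ η) (hX : X.Nonempty)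
    (hZ : Z.Nonempty) (hb : NoDenseRect X Z b K η) (j : ℕ) :
    corrMoment X X Z b b (j + 1) ≤ K ^ 2 * corrMoment X X Z b b j + 3 * η := by
  -- the bound for one weight `w`
  have key : ∀ w : α → ℝ, (∀ x, 0 ≤ w x) → (∀ x, w x ≤ 1) →
      𝔼 z ∈ Z, (𝔼 x ∈ X, w x * b x z) ^ 2 ≤ K ^ 2 * (𝔼 x ∈ X, w x) ^ 2 + 3 * η := by
    intro w hw0 hw1
    set g : ι → ℝ := fun z => 𝔼 x ∈ X, w x * b x z with hg
    have hg0 : ∀ z, 0 ≤ g z := fun z =>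
      Finset.expect_nonneg fun x _ => mul_nonneg (hw0 x) (h0 x z)
    have hg1 : ∀ z, g z ≤ 1 := fun z =>
      Finset.expect_le hX fun x _ => mul_le_one₀ (hw1 x) (h0 x z) (h1 x z)
    have e1 : 𝔼 z ∈ Z, g z ^ 2 = 𝔼 x ∈ X, 𝔼 z ∈ Z, w x * b x z * g z := by
      rw [Finset.expect_comm]
      refine Finset.expect_congr rfl fun z _ => ?_
      rw [← Finset.expect_mul, pow_two]
    have e2 : 𝔼 z ∈ Z, g z = 𝔼 x ∈ X, 𝔼 z ∈ Z, w x * b x z * 1 := by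
      rw [Finset.expect_comm]
      simp
    have i1 := hb w g hw0 hw1 hg0 hg1
    have i2 := hb w (fun _ => 1) hw0 hw1 (fun _ => zero_le_one) (fun _ => le_rfl)
    rw [← e1] at i1
    rw [← e2, Finset.expect_const hZ, mul_one] at i2
    have hW0 : 0 ≤ 𝔼 x ∈ X, w x := Finset.expect_nonneg fun x _ => hw0 x
    have hW1 : 𝔼 x ∈ X, w x ≤ 1 := Finset.expect_le hX fun x _ => hw1 x
    have i3 : K * (𝔼 x ∈ X, w x) * (𝔼 z ∈ Z, g z) ≤
        K * (𝔼 x ∈ X, w x) * (K * (𝔼 x ∈ X, w x) + η) :=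
      mul_le_mul_of_nonneg_left i2 (mul_nonneg hK0 hW0)
    have i4 : K * (𝔼 x ∈ X, w x) ≤ 2 := by nlinarith
    nlinarith [mul_le_mul_of_nonneg_right i4 hη]
  have e1 : corrMoment X X Z b b (j + 1) = 𝔼 q ∈ Fintype.piFinset fun _ : Fin j => Z,
      𝔼 z ∈ Z, (𝔼 x ∈ X, (∏ i, b x (q i)) * b x z) ^ 2 := by
    simp only [corrMoment, pow_succ _ j, Finset.expect_pow, Finset.expect_mul_expect, pow_two]
    rw [expect_rotate]
    refine Finset.expect_congr rfl fun q _ => ?_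
    rw [expect_rotate]
    refine Finset.expect_congr rfl fun z _ => Finset.expect_congr rfl fun x _ =>
      Finset.expect_congr rfl fun x' _ => ?_
    rw [Finset.prod_mul_distrib]
    ring
  have e2 : corrMoment X X Z b b j = 𝔼 q ∈ Fintype.piFinset fun _ : Fin j => Z,
      (𝔼 x ∈ X, ∏ i, b x (q i)) ^ 2 := by
    simp only [corrMoment_eq, pow_two]
  have hne : (Fintype.piFinset fun _ : Fin j => Z).Nonempty := by simpa using fun _ => hZ
  rw [e1, e2, Finset.mul_expect, ← Finset.expect_const hne (3 * η), ← Finset.expect_add_distrib]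
  refine Finset.expect_le_expect fun q _ => key _ (fun x => ?_) (fun x => ?_)
  · exact Finset.prod_nonneg fun i _ => h0 _ _
  · exact Finset.prod_le_one (fun i _ => h0 _ _) fun i _ => h1 _ _

end Moments

/-! ### Self-correlation of functions without dense rectangles -/

section SelfCorrelation

variable {α ι : Type*} {X : Finset α} {Z : Finset ι}

theorem corrMoment_le {b : α → ι → ℝ} {ε δ η : ℝ} (h0 : ∀ x z, 0 ≤ b x z)
    (h1 : ∀ x z, b x z ≤ 1) (hε0 : 0 ≤ ε) (hδ0 : 0 ≤ δ) (hδ1 : δ ≤ 1)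
    (hε : ε ≤ 1) (hη : 0 ≤ η) (hX : X.Nonempty) (hZ : Z.Nonempty)
    (hb : NoDenseRect X Z b ((1 + ε) * δ) η) (j : ℕ) :
    corrMoment X X Z b b j ≤ ((1 + ε) ^ 2) ^ j * ((δ ^ 2) ^ j + 3 * η * j) := by
  induction j with
  | zero => simp [corrMoment, hX]
  | succ j ih =>
    refine (corrMoment_succ_le h0 h1 (by positivity) (by nlinarith) hη hX hZ hb j).trans ?_
    have hL : 1 ≤ ((1 + ε) ^ 2) ^ (j + 1) := one_le_pow₀ (one_le_pow₀ (by linarith))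
    have hd : δ ^ 2 ≤ 1 := pow_le_one₀ hδ0 hδ1
    calc ((1 + ε) * δ) ^ 2 * corrMoment X X Z b b j + 3 * η
        ≤ ((1 + ε) * δ) ^ 2 * (((1 + ε) ^ 2) ^ j * ((δ ^ 2) ^ j + 3 * η * j)) + 3 * η := by gcongr
      _ = ((1 + ε) ^ 2) ^ (j + 1) * ((δ ^ 2) ^ (j + 1) + δ ^ 2 * (3 * η * j)) + 1 * (3 * η) := by
          ring
      _ ≤ ((1 + ε) ^ 2) ^ (j + 1) * ((δ ^ 2) ^ (j + 1) + 1 * (3 * η * j)) +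
          ((1 + ε) ^ 2) ^ (j + 1) * (3 * η) := by gcongr
      _ = _ := by push_cast; ring

theorem expect_add_pow_le {b : α → ι → ℝ} {A s : ℝ} (hs : 0 ≤ s) {P : ℕ}
    (hA : ∀ j ≤ P, corrMoment X X Z b b j ≤ 2 * A ^ j) :
    𝔼 x ∈ X, 𝔼 x' ∈ X, ((𝔼 z ∈ Z, b x z * b x' z) + s) ^ P ≤ 2 * (A + s) ^ P := by
  have h : 𝔼 x ∈ X, 𝔼 x' ∈ X, ((𝔼 z ∈ Z, b x z * b x' z) + s) ^ P =
      ∑ j ∈ Finset.range (P + 1), P.choose j * s ^ (P - j) * corrMoment X X Z b b j := by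
    simp only [add_pow, Finset.expect_sum_comm, corrMoment, Finset.mul_expect]
    refine Finset.sum_congr rfl fun j _ => Finset.expect_congr rfl fun x _ =>
      Finset.expect_congr rfl fun x' _ => ?_
    ring
  rw [h, add_pow, Finset.mul_sum]
  refine Finset.sum_le_sum fun j hj => ?_
  have := hA j (Nat.lt_succ_iff.1 (Finset.mem_range.1 hj))
  calc P.choose j * s ^ (P - j) * corrMoment X X Z b b j
      ≤ P.choose j * s ^ (P - j) * (2 * A ^ j) := by gcongr
    _ = _ := by ring

theorem two_mul_pow_add_one_lt {p : ℕ} (hp : 4 ≤ p) :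
    2 * (51 / 50 : ℝ) ^ (17 * p + 1) + 1 < 2 ^ p := by
  have h1 : (51 / 50 : ℝ) ^ (17 * p + 1) ≤ (3 / 2) ^ p * (51 / 50) := by
    rw [pow_succ, pow_mul]
    gcongr
    norm_num
  obtain ⟨q, rfl⟩ := Nat.exists_eq_add_of_le hp
  have h2 : (3 / 2 : ℝ) ^ q ≤ 2 ^ q := by gcongr; norm_num
  have h3 : (1 : ℝ) ≤ 2 ^ q := one_le_pow₀ (by norm_num)
  have h4 : (3 / 2 : ℝ) ^ (4 + q) = 81 / 16 * (3 / 2) ^ q := by rw [pow_add]; norm_num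
  have h5 : (2 : ℝ) ^ (4 + q) = 16 * 2 ^ q := by rw [pow_add]; norm_num
  rw [h5]
  rw [h4] at h1
  linarith

/-- Restricted to rows of nearly full degree, the balanced function `b - δ` of a function without
dense rectangles has small self-correlation. All moments of the kernel `⟨f, f⟩` are nonnegative, so
a large `p`-th moment would force `⟨f, f⟩ + δ ^ 2` to have a large moment of the higher order
`17 * p + 1`; that order is odd and `⟨f, f⟩ + δ ^ 2` is at most about `⟨b, b⟩`, whose moments are
bounded. -/
theorem corrMoment_balanced_lt [DecidableEq α] {b : α → ι → ℝ} {δ η : ℝ} {p : ℕ} {G : Finset α}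
    (h0 : ∀ x z, 0 ≤ b x z) (h1 : ∀ x z, b x z ≤ 1) (hδ0 : 0 < δ) (hδ1 : δ ≤ 1)
    (hη : 0 ≤ η) (hX : X.Nonempty) (hZ : Z.Nonempty)
    (hb : NoDenseRect X Z b ((1 + 1 / 10000) * δ) η)
    (hG : ∀ x ∈ G, (1 - 1 / 200) * δ ≤ 𝔼 z ∈ Z, b x z) (hp : 4 ≤ p) (hpe : Even p)
    (hηP : 100000 * (17 * p + 1 : ℕ) * η ≤ (δ ^ 2) ^ (17 * p + 1)) :
    corrMoment X X Z (fun x z => if x ∈ G then b x z - δ else 0)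
      (fun x z => if x ∈ G then b x z - δ else 0) p < (δ ^ 2 / 8) ^ p := by
  set f : α → ι → ℝ := fun x z => if x ∈ G then b x z - δ else 0 with hf
  set P := 17 * p + 1 with hP
  by_contra! hcon
  have hodd : Odd P := (hpe.mul_left 17).add_one
  have hd1 : δ ^ 2 ≤ 1 := pow_le_one₀ hδ0.le hδ1
  have lower := choose_mul_corrMoment_le (X := X) (Z := Z) f (sq_nonneg δ) (show p ≤ P by omega)
  have hpt : ∀ x x', ((𝔼 z ∈ Z, f x z * f x' z) + δ ^ 2) ^ P ≤
      ((𝔼 z ∈ Z, b x z * b x' z) + δ ^ 2 / 100) ^ P + (δ ^ 2) ^ P := by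
    intro x x'
    have hbb : 0 ≤ 𝔼 z ∈ Z, b x z * b x' z :=
      Finset.expect_nonneg fun z _ => mul_nonneg (h0 _ _) (h0 _ _)
    by_cases hx : x ∈ G
    · by_cases hx' : x' ∈ G
      · have e : 𝔼 z ∈ Z, f x z * f x' z =
            (𝔼 z ∈ Z, b x z * b x' z) - δ * (𝔼 z ∈ Z, b x z) - δ * (𝔼 z ∈ Z, b x' z) + δ ^ 2 := by
          simp only [hf, hx, hx', if_true, Finset.mul_expect]
          rw [← Finset.expect_const hZ (δ ^ 2), ← Finset.expect_sub_distrib,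
            ← Finset.expect_sub_distrib, ← Finset.expect_add_distrib]
          exact Finset.expect_congr rfl fun z _ => by ring
        have : (𝔼 z ∈ Z, f x z * f x' z) + δ ^ 2 ≤ (𝔼 z ∈ Z, b x z * b x' z) + δ ^ 2 / 100 := by
          rw [e]
          nlinarith [hG x hx, hG x' hx']
        have := hodd.pow_le_pow.2 this
        have : 0 ≤ (δ ^ 2) ^ P := by positivity
        linarith
      · have : 0 ≤ ((𝔼 z ∈ Z, b x z * b x' z) + δ ^ 2 / 100) ^ P := by positivity
        simpa [hf, hx'] using this
    · have : 0 ≤ ((𝔼 z ∈ Z, b x z * b x' z) + δ ^ 2 / 100) ^ P := by positivity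
      simpa [hf, hx] using this
  have upper : 𝔼 x ∈ X, 𝔼 x' ∈ X, ((𝔼 z ∈ Z, f x z * f x' z) + δ ^ 2) ^ P ≤
      (𝔼 x ∈ X, 𝔼 x' ∈ X, ((𝔼 z ∈ Z, b x z * b x' z) + δ ^ 2 / 100) ^ P) + (δ ^ 2) ^ P := by
    refine (Finset.expect_le_expect fun x _ => Finset.expect_le_expect fun x' _ =>
      hpt x x').trans_eq ?_
    simp only [Finset.expect_add_distrib, Finset.expect_const hX]
  have hmom : ∀ j ≤ P, corrMoment X X Z b b j ≤ 2 * ((1 + 1 / 10000) ^ 2 * δ ^ 2) ^ j := by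
    intro j hj
    refine (corrMoment_le h0 h1 (by norm_num) hδ0.le hδ1 (by norm_num) hη hX hZ hb j).trans ?_
    have hj' : (j : ℝ) ≤ P := by exact_mod_cast hj
    have h3 : 3 * η * j ≤ (δ ^ 2) ^ j := by
      calc 3 * η * j ≤ 3 * η * P := by gcongr
        _ ≤ 100000 * P * η := by nlinarith [mul_nonneg (Nat.cast_nonneg (α := ℝ) P) hη]
        _ ≤ (δ ^ 2) ^ P := hηP
        _ ≤ (δ ^ 2) ^ j := pow_le_pow_of_le_one (by positivity) hd1 hj
    rw [mul_pow]
    have : (0 : ℝ) ≤ ((1 + 1 / 10000) ^ 2) ^ j := by positivity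
    nlinarith
  have upper2 := expect_add_pow_le (X := X) (Z := Z) (by positivity : 0 ≤ δ ^ 2 / 100) hmom
  have upper3 : ((1 + 1 / 10000) ^ 2 * δ ^ 2 + δ ^ 2 / 100) ^ P ≤ (51 / 50) ^ P * (δ ^ 2) ^ P := by
    rw [← mul_pow (51 / 50 : ℝ)]
    exact pow_le_pow_left₀ (by positivity) (by nlinarith [sq_nonneg δ]) P
  have hc : (16 : ℝ) ^ p ≤ P.choose p := by exact_mod_cast pow_le_choose_seventeen p
  have lower2 : 2 ^ p * (δ ^ 2) ^ P ≤ P.choose p * (δ ^ 2) ^ (P - p) * corrMoment X X Z f f p := by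
    calc 2 ^ p * (δ ^ 2) ^ P = 16 ^ p * (δ ^ 2) ^ (P - p) * (δ ^ 2 / 8) ^ p := by
          rw [← pow_sub_mul_pow (δ ^ 2) (show p ≤ P by omega), div_pow,
            show (16 : ℝ) = 2 * 8 by norm_num, mul_pow]
          field_simp
      _ ≤ _ := by gcongr
  have hpos : 0 < (δ ^ 2) ^ P := by positivity
  nlinarith [mul_lt_mul_of_pos_right (two_mul_pow_add_one_lt hp) hpos]

end SelfCorrelation

/-! ### Counting triangles -/

section Triangle

variable {α β ι : Type*} {X : Finset α} {Y : Finset β} {Z : Finset ι}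

/-- If `b` has average at least `δ` and no dense rectangles, few rows have degree much below `δ`. -/
theorem expect_low_degree_le [DecidableEq α] {b : α → ι → ℝ} {δ η : ℝ} {G : Finset α}
    (hδ0 : 0 < δ) (hη : η ≤ δ / 100000) (hX : X.Nonempty) (hZ : Z.Nonempty)
    (hb : NoDenseRect X Z b ((1 + 1 / 10000) * δ) η) (hm : δ ≤ 𝔼 x ∈ X, 𝔼 z ∈ Z, b x z)
    (hG : ∀ x ∈ X, x ∉ G → 𝔼 z ∈ Z, b x z ≤ (1 - 1 / 200) * δ) :
    𝔼 x ∈ X, (if x ∈ G then 0 else 1 : ℝ) ≤ 3 / 100 := by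
  set u : α → ℝ := fun x => if x ∈ G then 0 else 1 with hu
  have hu0 : ∀ x, 0 ≤ u x := fun x => by simp only [hu]; split_ifs <;> norm_num
  have hu1 : ∀ x, u x ≤ 1 := fun x => by simp only [hu]; split_ifs <;> norm_num
  have i1 := hb (fun x => 1 - u x) (fun _ => 1) (fun x => sub_nonneg.2 (hu1 x))
    (fun x => by linarith [hu0 x]) (fun _ => zero_le_one) (fun _ => le_rfl)
  have i2 : 𝔼 x ∈ X, 𝔼 z ∈ Z, u x * b x z ≤ (1 - 1 / 200) * δ * 𝔼 x ∈ X, u x := by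
    rw [Finset.mul_expect]
    refine Finset.expect_le_expect fun x hxX => ?_
    rw [← Finset.mul_expect]
    by_cases hx : x ∈ G
    · simp [hu, hx]
    · simpa [hu, hx] using hG x hxX hx
  have e : 𝔼 x ∈ X, 𝔼 z ∈ Z, b x z = (𝔼 x ∈ X, 𝔼 z ∈ Z, (1 - u x) * b x z * 1) +
      𝔼 x ∈ X, 𝔼 z ∈ Z, u x * b x z := by
    simp only [← Finset.expect_add_distrib]
    refine Finset.expect_congr rfl fun x _ => Finset.expect_congr rfl fun z _ => by ring
  rw [Finset.expect_sub_distrib, Finset.expect_const hX, Finset.expect_const hZ] at i1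
  have : δ * (𝔼 x ∈ X, u x) ≤ δ * (3 / 100) := by
    rw [e] at hm
    nlinarith
  exact le_of_mul_le_mul_left this hδ0

/-- The tangent line of the even function `h ^ p` at `-s`. -/
theorem tangent_le_even_pow {p : ℕ} (hp : Even p) {s : ℝ} (hs : 0 < s) (h : ℝ) :
    s ^ p - p * (s ^ p / s) * (h + s) ≤ h ^ p := by
  have key : ∀ t : ℝ, 1 + p * (t - 1) ≤ t ^ p := by
    intro t
    rcases le_or_gt (-1) t with ht | ht
    · exact one_add_mul_sub_le_pow ht p
    · rcases Nat.eq_zero_or_pos p with rfl | hp0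
      · simp
      · have : (1 : ℝ) ≤ p := by exact_mod_cast hp0
        have := hp.pow_nonneg t
        nlinarith
  have h1 := mul_le_mul_of_nonneg_left (key (-h / s)) (pow_nonneg hs.le p)
  have h2 : s ^ p * (-h / s) ^ p = h ^ p := by
    rw [← mul_pow, mul_div_cancel₀ _ hs.ne', hp.neg_pow]
  rw [h2] at h1
  refine le_trans (le_of_eq ?_) h1
  field_simp
  ring

/-- A counting lemma: functions of density about `δ` without dense rectangles have at least a
constant fraction of the triangles expected at random. -/
theorem triangle_lower_bound {a : α → β → ℝ} {b : α → ι → ℝ} {c : β → ι → ℝ} {δ η : ℝ} {p : ℕ}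
    (ha0 : ∀ x y, 0 ≤ a x y) (ha1 : ∀ x y, a x y ≤ 1) (hb0 : ∀ x z, 0 ≤ b x z)
    (hb1 : ∀ x z, b x z ≤ 1) (hc0 : ∀ y z, 0 ≤ c y z) (hc1 : ∀ y z, c y z ≤ 1)
    (hδ0 : 0 < δ) (hδ1 : δ ≤ 1) (hη : 0 ≤ η) (hX : X.Nonempty) (hY : Y.Nonempty) (hZ : Z.Nonempty)
    (ha : NoDenseRect X Y a ((1 + 1 / 10000) * δ) η)
    (hb : NoDenseRect X Z b ((1 + 1 / 10000) * δ) η)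
    (hc : NoDenseRect Y Z c ((1 + 1 / 10000) * δ) η)
    (hma : δ ≤ 𝔼 x ∈ X, 𝔼 y ∈ Y, a x y) (hmb : δ ≤ 𝔼 x ∈ X, 𝔼 z ∈ Z, b x z)
    (hmc : δ ≤ 𝔼 y ∈ Y, 𝔼 z ∈ Z, c y z)
    (hp : 4 ≤ p) (hpe : Even p) (hδp : (1 / 2) ^ p ≤ δ)
    (hηP : 100000 * (17 * p + 1 : ℕ) * η ≤ (δ ^ 2) ^ (17 * p + 1)) :
    δ ^ 3 / 4 ≤ 𝔼 x ∈ X, 𝔼 y ∈ Y, 𝔼 z ∈ Z, a x y * (b x z * c y z) := by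
  classical
  have hηδ : η ≤ δ / 100000 := by
    have h1 : (δ ^ 2) ^ (17 * p + 1) ≤ δ := by
      rw [← pow_mul]; exact pow_le_of_le_one hδ0.le hδ1 (by omega)
    have h2 : (1 : ℝ) ≤ (17 * p + 1 : ℕ) := by norm_cast; omega
    nlinarith
  by_contra! hlt
  -- the rows of `b` and of `c` whose degree is nearly full
  set G : Finset α := X.filter fun x => (1 - 1 / 200) * δ ≤ 𝔼 z ∈ Z, b x z with hGdef
  set H : Finset β := Y.filter fun y => (1 - 1 / 200) * δ ≤ 𝔼 z ∈ Z, c y z with hHdef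
  have hG : ∀ x ∈ G, (1 - 1 / 200) * δ ≤ 𝔼 z ∈ Z, b x z := fun x hx => (Finset.mem_filter.1 hx).2
  have hH : ∀ y ∈ H, (1 - 1 / 200) * δ ≤ 𝔼 z ∈ Z, c y z := fun y hy => (Finset.mem_filter.1 hy).2
  set f : α → ι → ℝ := fun x z => if x ∈ G then b x z - δ else 0 with hf
  set g : β → ι → ℝ := fun y z => if y ∈ H then c y z - δ else 0 with hg
  have hff := corrMoment_balanced_lt hb0 hb1 hδ0 hδ1 hη hX hZ hb hG hp hpe hηP
  have hgg := corrMoment_balanced_lt hc0 hc1 hδ0 hδ1 hη hY hZ hc hH hp hpe hηP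
  set u : α → ℝ := fun x => if x ∈ G then 0 else 1 with hu
  set v : β → ℝ := fun y => if y ∈ H then 0 else 1 with hv
  have hu0 : ∀ x, 0 ≤ u x := fun x => by simp only [hu]; split_ifs <;> norm_num
  have hu1 : ∀ x, u x ≤ 1 := fun x => by simp only [hu]; split_ifs <;> norm_num
  have hv0 : ∀ x, 0 ≤ v x := fun x => by simp only [hv]; split_ifs <;> norm_num
  have hv1 : ∀ x, v x ≤ 1 := fun x => by simp only [hv]; split_ifs <;> norm_num
  have hbu : 𝔼 x ∈ X, u x ≤ 3 / 100 :=
    expect_low_degree_le hδ0 hηδ hX hZ hb hmb fun x hx hxG => by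
      by_contra! hlow
      exact hxG (Finset.mem_filter.2 ⟨hx, hlow.le⟩)
  have hbv : 𝔼 y ∈ Y, v y ≤ 3 / 100 :=
    expect_low_degree_le hδ0 hηδ hY hZ hc hmc fun x hx hxG => by
      by_contra! hlow
      exact hxG (Finset.mem_filter.2 ⟨hx, hlow.le⟩)
  -- the weight of `a` on bad rows, on bad columns, and in total
  have w1 := ha u (fun _ => 1) hu0 hu1 (fun _ => zero_le_one) (fun _ => le_rfl)
  have w2 := ha (fun _ => 1) v (fun _ => zero_le_one) (fun _ => le_rfl) hv0 hv1
  have w3 := ha (fun _ => 1) (fun _ => 1) (fun _ => zero_le_one) (fun _ => le_rfl)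
    (fun _ => zero_le_one) (fun _ => le_rfl)
  simp only [Finset.expect_const hX, Finset.expect_const hY, mul_one, one_mul] at w1 w2 w3
  set h : α → β → ℝ := fun x y => 𝔼 z ∈ Z, f x z * g y z with hh
  have hpt : ∀ x y, a x y * h x y ≤ (𝔼 z ∈ Z, a x y * (b x z * c y z)) -
      99 / 100 * δ ^ 2 * (a x y - u x * a x y - a x y * v y) := by
    intro x y
    have habc : 0 ≤ 𝔼 z ∈ Z, a x y * (b x z * c y z) :=
      Finset.expect_nonneg fun z _ => mul_nonneg (ha0 _ _) (mul_nonneg (hb0 _ _) (hc0 _ _))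
    have hpos : 0 ≤ δ ^ 2 * a x y := mul_nonneg (sq_nonneg _) (ha0 x y)
    by_cases hx : x ∈ G
    · by_cases hy : y ∈ H
      · have e : h x y = (𝔼 z ∈ Z, b x z * c y z) - δ * (𝔼 z ∈ Z, b x z)
            - δ * (𝔼 z ∈ Z, c y z) + δ ^ 2 := by
          simp only [hh, hf, hg, hx, hy, if_true, Finset.mul_expect]
          rw [← Finset.expect_const hZ (δ ^ 2), ← Finset.expect_sub_distrib,
            ← Finset.expect_sub_distrib, ← Finset.expect_add_distrib]
          exact Finset.expect_congr rfl fun z _ => by ring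
        have h1 : h x y ≤ (𝔼 z ∈ Z, b x z * c y z) - 99 / 100 * δ ^ 2 := by
          rw [e]
          nlinarith [hG x hx, hH y hy]
        have h2 := mul_le_mul_of_nonneg_left h1 (ha0 x y)
        simp only [hu, hv, hx, hy, if_true, ← Finset.mul_expect]
        linarith
      · simp only [hh, hg, hu, hv, hy, if_false, mul_zero, Finset.expect_const_zero]
        nlinarith [mul_nonneg (hu0 x) hpos]
    · simp only [hh, hf, hu, hv, hx, if_false, zero_mul, mul_zero, Finset.expect_const_zero]
      nlinarith [mul_nonneg (hv0 y) hpos]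
  have hah : 𝔼 x ∈ X, 𝔼 y ∈ Y, a x y * h x y ≤ -(δ ^ 3 / 2) := by
    have h1 := Finset.expect_le_expect fun x (_ : x ∈ X) =>
      Finset.expect_le_expect fun y (_ : y ∈ Y) => hpt x y
    simp only [Finset.expect_sub_distrib, ← Finset.mul_expect] at h1 w1 hlt ⊢
    have h3 : 0 < δ ^ 3 := by positivity
    have h2 : 9 / 10 * δ ≤ (𝔼 x ∈ X, 𝔼 y ∈ Y, a x y) - (𝔼 x ∈ X, u x * 𝔼 y ∈ Y, a x y) -
        𝔼 x ∈ X, 𝔼 y ∈ Y, a x y * v y := by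
      nlinarith
    nlinarith [mul_le_mul_of_nonneg_left h2 (sq_nonneg δ)]
  set s := δ ^ 2 / 4 with hs
  have hs0 : 0 < s := by positivity
  have hmom : (δ ^ 2 / 8) ^ p ≤ corrMoment X Y Z f g p := by
    -- weighting the tangent line by `a` turns the first moment into a bound on the `p`-th one
    have h1 : ∀ x y, a x y * s ^ p - p * (s ^ p / s) * (a x y * h x y + a x y * s) ≤ h x y ^ p := by
      intro x y
      have t1 := mul_le_mul_of_nonneg_left (tangent_le_even_pow hpe hs0 (h x y)) (ha0 x y)
      have t2 := mul_le_mul_of_nonneg_right (ha1 x y) (hpe.pow_nonneg (h x y))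
      linarith
    have h2 := Finset.expect_le_expect fun x (_ : x ∈ X) =>
      Finset.expect_le_expect fun y (_ : y ∈ Y) => h1 x y
    simp only [Finset.expect_sub_distrib, ← Finset.mul_expect, Finset.expect_add_distrib,
      ← Finset.expect_mul] at h2
    have h3 : (𝔼 x ∈ X, 𝔼 y ∈ Y, a x y * h x y) + (𝔼 x ∈ X, 𝔼 y ∈ Y, a x y) * s ≤ 0 := by
      have : 𝔼 x ∈ X, 𝔼 y ∈ Y, a x y ≤ 2 * δ := by linarith
      have := mul_le_mul_of_nonneg_right this hs0.le
      rw [hs] at this ⊢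
      linarith
    have h4 : 0 ≤ p * (s ^ p / s) := by positivity
    have h5 := mul_nonpos_of_nonneg_of_nonpos h4 h3
    have h6 : (δ ^ 2 / 8) ^ p ≤ δ * s ^ p := by
      have : δ ^ 2 / 8 = 1 / 2 * s := by rw [hs]; ring
      rw [this, mul_pow]
      gcongr
    have h7 := mul_le_mul_of_nonneg_right hma (pow_nonneg hs0.le p)
    simp only [corrMoment]
    linarith
  have hcs := corrMoment_sq_le (X := X) (Y := Y) (Z := Z) f g p
  have hD : 0 < (δ ^ 2 / 8) ^ p := by positivity
  have := mul_lt_mul'' hff hgg (corrMoment_self_nonneg f p) (corrMoment_self_nonneg g p)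
  nlinarith

end Triangle

/-! ### Weights, rectangles and truncated marginals -/

section Truncation

variable {α β ι : Type*}

theorem sum_mul_le_sum_filter (U : Finset α) (u φ : α → ℝ) (hu0 : ∀ x, 0 ≤ u x)
    (hu1 : ∀ x, u x ≤ 1) :
    ∑ x ∈ U, u x * φ x ≤ ∑ x ∈ U.filter (fun x => 0 ≤ φ x), φ x := by
  rw [Finset.sum_filter]
  refine Finset.sum_le_sum fun x _ => ?_
  split_ifs with h
  · exact mul_le_of_le_one_left h (hu1 x)
  · exact mul_nonpos_of_nonneg_of_nonpos (hu0 x) (not_le.1 h).le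

/-- A linear functional of a `[0, 1]`-valued weight is largest on an indicator function, so only
genuine rectangles have to be checked. The small ones are absorbed by `η`. -/
theorem noDenseRect_of_sets {U : Finset α} {V : Finset β} {f : α → β → ℝ} {K η : ℝ}
    (hf1 : ∀ x y, f x y ≤ 1) (hK : 0 ≤ K) (hη : 0 ≤ η)
    (h : ∀ U' ⊆ U, ∀ V' ⊆ V, η * (U.card * V.card) ≤ (U'.card * V'.card : ℝ) →
      ∑ x ∈ U', ∑ y ∈ V', f x y ≤ K * (U'.card * V'.card)) :
    NoDenseRect U V f K η := by
  intro u v hu0 hu1 hv0 hv1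
  rcases U.eq_empty_or_nonempty with rfl | hU
  · simpa using hη
  rcases V.eq_empty_or_nonempty with rfl | hV
  · simpa using hη
  have hU0 : (0 : ℝ) < U.card := by exact_mod_cast hU.card_pos
  have hV0 : (0 : ℝ) < V.card := by exact_mod_cast hV.card_pos
  set φ : α → ℝ := fun x => ∑ y ∈ V, v y * (f x y - K) with hφ
  set U' := U.filter fun x => 0 ≤ φ x with hU'
  set ψ : β → ℝ := fun y => ∑ x ∈ U', (f x y - K) with hψ
  set V' := V.filter fun y => 0 ≤ ψ y with hV'
  have s1 : ∑ x ∈ U, u x * φ x ≤ ∑ x ∈ U', φ x := sum_mul_le_sum_filter U u φ hu0 hu1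
  have s2 : ∑ x ∈ U', φ x = ∑ y ∈ V, v y * ψ y := by
    simp only [hφ, hψ, Finset.mul_sum]
    exact Finset.sum_comm
  have s3 : ∑ y ∈ V, v y * ψ y ≤ ∑ y ∈ V', ψ y := sum_mul_le_sum_filter V v ψ hv0 hv1
  have s4 : ∑ y ∈ V', ψ y = (∑ x ∈ U', ∑ y ∈ V', f x y) - K * (U'.card * V'.card) := by
    simp only [hψ]
    rw [Finset.sum_comm]
    simp only [Finset.sum_sub_distrib, Finset.sum_const, nsmul_eq_mul]
    ring
  have s5 : ∑ x ∈ U', ∑ y ∈ V', f x y ≤ U'.card * V'.card := by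
    calc ∑ x ∈ U', ∑ y ∈ V', f x y ≤ ∑ x ∈ U', ∑ y ∈ V', (1 : ℝ) :=
          Finset.sum_le_sum fun x _ => Finset.sum_le_sum fun y _ => hf1 x y
      _ = _ := by simp
  have s6 : ∑ y ∈ V', ψ y ≤ η * (U.card * V.card) := by
    rw [s4]
    rcases le_or_gt (η * (U.card * V.card)) (U'.card * V'.card : ℝ) with hle | hgt
    · have := h U' (Finset.filter_subset _ _) V' (Finset.filter_subset _ _) hle
      have : (0 : ℝ) ≤ η * (U.card * V.card) := by positivity
      linarith
    · have : (0 : ℝ) ≤ K * (U'.card * V'.card) := by positivity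
      linarith
  have e : ∑ x ∈ U, u x * φ x =
      (∑ x ∈ U, ∑ y ∈ V, u x * f x y * v y) - K * (∑ x ∈ U, u x) * ∑ y ∈ V, v y := by
    rw [mul_assoc, Finset.sum_mul_sum, Finset.mul_sum, ← Finset.sum_sub_distrib]
    refine Finset.sum_congr rfl fun x _ => ?_
    rw [hφ, Finset.mul_sum, Finset.mul_sum, ← Finset.sum_sub_distrib]
    exact Finset.sum_congr rfl fun y _ => by ring
  have tot : (∑ x ∈ U, ∑ y ∈ V, u x * f x y * v y) ≤
      K * (∑ x ∈ U, u x) * (∑ y ∈ V, v y) + η * (U.card * V.card) := by linarith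
  simp only [Finset.expect_eq_sum_div_card, ← Finset.sum_div]
  rw [div_div, div_le_iff₀ (by positivity)]
  refine tot.trans (le_of_eq ?_)
  field_simp

/-- If the fibre averages of `D` concentrate around `μ`, truncating at `1` the normalized fibre
averages of some `T ≤ D` costs little. -/
theorem sub_le_expect_min {U : Finset α} {V : Finset β} {W : Finset ι} {T D : α → β → ι → ℝ}
    {μ γ s : ℝ} (hTD : ∀ x y z, T x y z ≤ D x y z) (hμ : 0 < μ) (hs : 0 < s) (hγ : 3 * γ ≤ s ^ 2)
    (hU : U.Nonempty) (hV : V.Nonempty)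
    (hdens : (1 - γ) * μ ≤ 𝔼 x ∈ U, 𝔼 y ∈ V, 𝔼 z ∈ W, D x y z)
    (hpair : 𝔼 x ∈ U, 𝔼 y ∈ V, (𝔼 z ∈ W, D x y z) ^ 2 ≤ (1 + γ) * μ ^ 2) :
    (𝔼 x ∈ U, 𝔼 y ∈ V, 𝔼 z ∈ W, T x y z) / μ - s ≤
      𝔼 x ∈ U, 𝔼 y ∈ V, min ((𝔼 z ∈ W, T x y z) / μ) 1 := by
  have hpt : ∀ x y, (𝔼 z ∈ W, T x y z) * (1 / μ) - ((𝔼 z ∈ W, D x y z) ^ 2 * (1 / (2 * s * μ ^ 2))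
      - (𝔼 z ∈ W, D x y z) * (1 / (s * μ)) + 1 / (2 * s) + s / 2) ≤
      min ((𝔼 z ∈ W, T x y z) / μ) 1 := by
    intro x y
    have hle : 𝔼 z ∈ W, T x y z ≤ 𝔼 z ∈ W, D x y z := Finset.expect_le_expect fun z _ => hTD x y z
    set t := 𝔼 z ∈ W, T x y z
    set r := 𝔼 z ∈ W, D x y z
    have hq : r ^ 2 * (1 / (2 * s * μ ^ 2)) - r * (1 / (s * μ)) + 1 / (2 * s) + s / 2 =
        (r / μ - 1) ^ 2 / (2 * s) + s / 2 := by field_simp; ring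
    have hq0 : 0 ≤ (r / μ - 1) ^ 2 / (2 * s) + s / 2 := by positivity
    -- the arithmetic-geometric mean inequality replaces Cauchy-Schwarz
    have hq1 : r / μ - 1 ≤ (r / μ - 1) ^ 2 / (2 * s) + s / 2 := by
      rw [div_add_div _ _ (by positivity) (by norm_num), le_div_iff₀ (by positivity)]
      nlinarith [sq_nonneg (r / μ - 1 - s)]
    have htr : t / μ ≤ r / μ := by gcongr
    rw [hq, mul_one_div]
    refine le_min (by linarith) (by linarith)
  have h := Finset.expect_le_expect fun x (_ : x ∈ U) =>
    Finset.expect_le_expect fun y (_ : y ∈ V) => hpt x y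
  simp only [Finset.expect_sub_distrib, Finset.expect_add_distrib, ← Finset.expect_mul,
    Finset.expect_const hU, Finset.expect_const hV] at h
  refine le_trans ?_ h
  set t := 𝔼 x ∈ U, 𝔼 y ∈ V, 𝔼 z ∈ W, T x y z
  set r := 𝔼 x ∈ U, 𝔼 y ∈ V, 𝔼 z ∈ W, D x y z
  set q := 𝔼 x ∈ U, 𝔼 y ∈ V, (𝔼 z ∈ W, D x y z) ^ 2
  have b1 : q * (1 / (2 * s * μ ^ 2)) ≤ (1 + γ) / (2 * s) := by
    rw [mul_one_div, div_le_div_iff₀ (by positivity) (by positivity)]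
    nlinarith
  have b2 : (1 - γ) / s ≤ r * (1 / (s * μ)) := by
    rw [mul_one_div, div_le_div_iff₀ (by positivity) (by positivity)]
    nlinarith
  have b3 : (1 + γ) / (2 * s) - (1 - γ) / s + 1 / (2 * s) ≤ s / 2 := by
    have : (1 + γ) / (2 * s) - (1 - γ) / s + 1 / (2 * s) = 3 * γ / (2 * s) := by field_simp; ring
    rw [this, div_le_div_iff₀ (by positivity) (by norm_num)]
    nlinarith
  rw [mul_one_div]
  linarith

end Truncation

/-! ### Stable cubes and densities -/

section Cubes

variable {α β ι : Type*}

/-- For a truncated marginal a dense rectangle is a cube `U' × V' × W` of large `T`-density. -/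
theorem noDenseRect_min {U : Finset α} {V : Finset β} {W : Finset ι} {T : α → β → ι → ℝ}
    {μ K η : ℝ} (hK : 0 ≤ K) (hη : 0 ≤ η)
    (h : ∀ U' ⊆ U, ∀ V' ⊆ V, η * (U.card * V.card) ≤ (U'.card * V'.card : ℝ) →
      (𝔼 x ∈ U', 𝔼 y ∈ V', 𝔼 z ∈ W, T x y z) / μ ≤ K) :
    NoDenseRect U V (fun x y => min ((𝔼 z ∈ W, T x y z) / μ) 1) K η := by
  refine noDenseRect_of_sets (fun x y => min_le_right _ _) hK hη fun U' hU' V' hV' hc => ?_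
  have h1 := h U' hU' V' hV' hc
  calc ∑ x ∈ U', ∑ y ∈ V', min ((𝔼 z ∈ W, T x y z) / μ) 1
      ≤ ∑ x ∈ U', ∑ y ∈ V', (𝔼 z ∈ W, T x y z) / μ :=
        Finset.sum_le_sum fun x _ => Finset.sum_le_sum fun y _ => min_le_left _ _
    _ = ((𝔼 x ∈ U', 𝔼 y ∈ V', 𝔼 z ∈ W, T x y z) / μ) * (U'.card * V'.card) := by
        simp only [← Finset.card_mul_expect, ← Finset.mul_expect, ← Finset.expect_div]
        ring
    _ ≤ _ := by gcongr

/-- Trading the value of `τ` against the size of the cube: a maximizer of `τ ^ m` times the size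
is large, and `τ` cannot grow by a factor `1 + e` on a subset that is not much smaller. -/
theorem exists_stable_cube {N : ℕ} {τ : Finset (Fin N) → Finset (Fin N) → Finset (Fin N) → ℝ}
    {γ e η τ₀ : ℝ} {m : ℕ} (hN : 0 < N) (hτ0 : ∀ X Y Z, 0 ≤ τ X Y Z) (hm : m ≠ 0) (he : 0 ≤ e)
    (hη : 0 < η) (hηm : 1 ≤ η * (1 + e) ^ m) (hτpos : 0 < τ₀)
    (hτu : τ₀ ≤ τ Finset.univ Finset.univ Finset.univ)
    (hτ2 : ∀ X Y Z : Finset (Fin N), γ * (N : ℝ) ^ 3 ≤ (X.card * Y.card * Z.card : ℝ) →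
      τ X Y Z ≤ 2)
    (hγ1 : γ ≤ 1) (hγ : γ ≤ η * (τ₀ / 2) ^ m) :
    ∃ X Y Z : Finset (Fin N), γ * (N : ℝ) ^ 3 ≤ (X.card * Y.card * Z.card : ℝ) ∧
      τ₀ ≤ τ X Y Z ∧ (τ₀ / 2) ^ m * (N : ℝ) ^ 3 ≤ (X.card * Y.card * Z.card : ℝ) ∧
      ∀ X' Y' Z' : Finset (Fin N), η * (X.card * Y.card * Z.card) ≤
        (X'.card * Y'.card * Z'.card : ℝ) → τ X' Y' Z' ≤ (1 + e) * τ X Y Z := by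
  classical
  have hN3 : (0 : ℝ) < (N : ℝ) ^ 3 := by positivity
  obtain ⟨⟨X, Y, Z⟩, hmem, hmax⟩ := Finset.exists_max_image
    ((Finset.univ : Finset (Finset (Fin N) × Finset (Fin N) × Finset (Fin N))).filter fun q =>
      γ * (N : ℝ) ^ 3 ≤ (q.1.card * q.2.1.card * q.2.2.card : ℝ))
    (fun q => τ q.1 q.2.1 q.2.2 ^ m * (q.1.card * q.2.1.card * q.2.2.card : ℝ))
    ⟨(Finset.univ, Finset.univ, Finset.univ), by
      simp only [Finset.mem_filter, Finset.mem_univ, true_and, Finset.card_univ, Fintype.card_fin]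
      nlinarith⟩
  simp only [Finset.mem_filter, Finset.mem_univ, true_and] at hmem hmax
  have hmax' : ∀ X' Y' Z' : Finset (Fin N), γ * (N : ℝ) ^ 3 ≤ (X'.card * Y'.card * Z'.card : ℝ) →
      τ X' Y' Z' ^ m * (X'.card * Y'.card * Z'.card : ℝ) ≤
      τ X Y Z ^ m * (X.card * Y.card * Z.card : ℝ) := fun X' Y' Z' h => hmax (X', Y', Z') h
  clear hmax
  set S : ℝ := X.card * Y.card * Z.card with hS
  have hcard : ∀ V : Finset (Fin N), (V.card : ℝ) ≤ N := fun V => by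
    exact_mod_cast (Finset.card_le_univ V).trans_eq (Fintype.card_fin N)
  have hSN : S ≤ (N : ℝ) ^ 3 := by
    calc S ≤ N * N * N := by rw [hS]; gcongr <;> exact_mod_cast hcard _
      _ = _ := by ring
  have hS0 : 0 ≤ S := by positivity
  have hu := hmax' Finset.univ Finset.univ Finset.univ (by
    simp only [Finset.card_univ, Fintype.card_fin]; nlinarith)
  simp only [Finset.card_univ, Fintype.card_fin] at hu
  have hu' : τ₀ ^ m * (N : ℝ) ^ 3 ≤ τ X Y Z ^ m * S := by
    refine le_trans ?_ hu
    have : (N : ℝ) * N * N = (N : ℝ) ^ 3 := by ring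
    rw [this]
    gcongr
  have hτm : 0 ≤ τ X Y Z ^ m := pow_nonneg (hτ0 _ _ _) m
  -- the maximizer is compared with the full grid
  have hlow : τ₀ ≤ τ X Y Z := by
    have : τ₀ ^ m * (N : ℝ) ^ 3 ≤ τ X Y Z ^ m * (N : ℝ) ^ 3 :=
      hu'.trans (mul_le_mul_of_nonneg_left hSN hτm)
    exact le_of_pow_le_pow_left₀ hm (hτ0 _ _ _) (le_of_mul_le_mul_right this hN3)
  have hbig : (τ₀ / 2) ^ m * (N : ℝ) ^ 3 ≤ S := by
    have h2 : τ X Y Z ^ m ≤ 2 ^ m := pow_le_pow_left₀ (hτ0 _ _ _) (hτ2 X Y Z hmem) m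
    have h3 := hu'.trans (mul_le_mul_of_nonneg_right h2 hS0)
    rw [div_pow, div_mul_eq_mul_div, div_le_iff₀ (by positivity)]
    linarith
  refine ⟨X, Y, Z, hmem, hlow, hbig, fun X' Y' Z' hle => ?_⟩
  by_contra! hgt
  have hlarge : γ * (N : ℝ) ^ 3 ≤ (X'.card * Y'.card * Z'.card : ℝ) := by
    refine le_trans ?_ hle
    calc γ * (N : ℝ) ^ 3 ≤ η * (τ₀ / 2) ^ m * (N : ℝ) ^ 3 := by gcongr
      _ = η * ((τ₀ / 2) ^ m * (N : ℝ) ^ 3) := by ring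
      _ ≤ η * S := by gcongr
  have h1 := hmax' X' Y' Z' hlarge
  have hτ : 0 < τ X Y Z := hτpos.trans_le hlow
  have hSpos : 0 < S := lt_of_lt_of_le (by positivity) hbig
  have h2 : ((1 + e) * τ X Y Z) ^ m < τ X' Y' Z' ^ m := pow_lt_pow_left₀ hgt (by positivity) hm
  have h3 : τ X Y Z ^ m * S < τ X Y Z ^ m * S :=
    calc τ X Y Z ^ m * S = 1 * (τ X Y Z ^ m * S) := by ring
      _ ≤ η * (1 + e) ^ m * (τ X Y Z ^ m * S) := by gcongr
      _ = ((1 + e) * τ X Y Z) ^ m * (η * S) := by rw [mul_pow]; ring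
      _ < τ X' Y' Z' ^ m * (η * S) := by gcongr
      _ ≤ τ X' Y' Z' ^ m * (X'.card * Y'.card * Z'.card : ℝ) := by
          have := pow_nonneg (hτ0 X' Y' Z') m
          gcongr
      _ ≤ _ := h1
  exact lt_irrefl _ h3

theorem density_eq {N : ℕ} (D : Finset (Grid N)) : density D = D.card / (N : ℝ) ^ 3 := by
  rw [density, Finset.expect_eq_sum_div_card]
  simp only [ind, Finset.sum_ite_mem, Finset.univ_inter, Finset.sum_const, nsmul_eq_mul, mul_one,
    Finset.card_univ, Fintype.card_prod, Fintype.card_fin]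
  push_cast
  ring

theorem density_eq_expect {N : ℕ} (D : Finset (Grid N)) :
    density D = 𝔼 x : Fin N, 𝔼 y : Fin N, 𝔼 z : Fin N, ind D (x, y, z) := by
  rw [density, ← Finset.univ_product_univ, Finset.expect_product]
  refine Finset.expect_congr rfl fun x _ => ?_
  rw [← Finset.univ_product_univ, Finset.expect_product]

theorem ind_nonneg {N : ℕ} (D : Finset (Grid N)) (p : Grid N) : 0 ≤ ind D p := by
  simp only [ind]; split_ifs <;> norm_num

theorem ind_mono {N : ℕ} {T D : Finset (Grid N)} (h : T ⊆ D) (p : Grid N) : ind T p ≤ ind D p := by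
  simp only [ind]
  by_cases hp : p ∈ T
  · simp [hp, h hp]
  · simp only [hp, if_false]; split_ifs <;> norm_num

theorem expect_ind_le_card {N : ℕ} (F : Finset (Grid N)) (X Y Z : Finset (Fin N)) :
    (𝔼 x ∈ X, 𝔼 y ∈ Y, 𝔼 z ∈ Z, ind F (x, y, z)) * (X.card * Y.card * Z.card) ≤ F.card := by
  have h1 : (𝔼 x ∈ X, 𝔼 y ∈ Y, 𝔼 z ∈ Z, ind F (x, y, z)) * (X.card * Y.card * Z.card) =
      ∑ p ∈ X ×ˢ Y ×ˢ Z, ind F p := by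
    rw [← Finset.card_mul_expect]
    simp only [Finset.expect_product, Finset.card_product]
    push_cast
    ring
  rw [h1]
  calc ∑ p ∈ X ×ˢ Y ×ˢ Z, ind F p ≤ ∑ p, ind F p :=
        Finset.sum_le_univ_sum_of_nonneg fun p => ind_nonneg F p
    _ = F.card := by simp [ind]

end Cubes

/-! ### Cylinder intersections on a pseudorandom set -/

/-- For `δ ≥ 2 ^ (-O(n))` and `p = 2 * n + 2` the hypothesis of `triangle_lower_bound` on `η` is met by
`η = 2 ^ (-300 * n ^ 2)`. -/
theorem exponent_bound {n : ℕ} (hn : 1 ≤ n) {δ : ℝ} (hδ : (1 / 2) ^ (n + 1) ≤ δ) :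
    100000 * (17 * (2 * n + 2) + 1 : ℕ) * (1 / 2 : ℝ) ^ (300 * n ^ 2) ≤
      (δ ^ 2) ^ (17 * (2 * n + 2) + 1) := by
  have hnn : n ≤ n ^ 2 := by nlinarith
  have h1 : (1 / 2 : ℝ) ^ (276 * n ^ 2) ≤ (δ ^ 2) ^ (17 * (2 * n + 2) + 1) := by
    calc (1 / 2 : ℝ) ^ (276 * n ^ 2) ≤ (1 / 2) ^ ((n + 1) * (2 * (17 * (2 * n + 2) + 1))) :=
          pow_le_pow_of_le_one (by norm_num) (by norm_num) (by nlinarith)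
      _ = ((1 / 2) ^ (n + 1)) ^ (2 * (17 * (2 * n + 2) + 1)) := pow_mul _ _ _
      _ ≤ δ ^ (2 * (17 * (2 * n + 2) + 1)) := by gcongr
      _ = _ := pow_mul _ _ _
  have h2 : (100000 * (17 * (2 * n + 2) + 1 : ℕ) : ℝ) ≤ 2 ^ (24 * n ^ 2) := by
    have h3 : 100000 * (17 * (2 * n + 2) + 1) ≤ 2 ^ 23 * n := by omega
    have h4 : 2 ^ 23 * n ≤ 2 ^ (24 * n ^ 2) := by
      calc 2 ^ 23 * n ≤ 2 ^ 23 * 2 ^ n := by gcongr; exact Nat.lt_two_pow_self.le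
        _ = 2 ^ (23 + n) := (pow_add _ _ _).symm
        _ ≤ 2 ^ (24 * n ^ 2) := Nat.pow_le_pow_right (by norm_num) (by nlinarith)
    exact_mod_cast h3.trans h4
  refine le_trans ?_ h1
  calc 100000 * (17 * (2 * n + 2) + 1 : ℕ) * (1 / 2 : ℝ) ^ (300 * n ^ 2)
      ≤ 2 ^ (24 * n ^ 2) * (1 / 2 : ℝ) ^ (300 * n ^ 2) := by gcongr
    _ = 2 ^ (24 * n ^ 2) * ((1 / 2 : ℝ) ^ (24 * n ^ 2) * (1 / 2 : ℝ) ^ (276 * n ^ 2)) := by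
        rw [← pow_add]; congr 2; ring
    _ = (1 / 2 : ℝ) ^ (276 * n ^ 2) := by
        rw [← mul_assoc, ← mul_pow]; norm_num

theorem half_pow_mul_pow_ge (k : ℕ) :
    1 ≤ (1 / 2 : ℝ) ^ k * (1 + 1 / 20000) ^ (20000 * k) := by
  have h : (2 : ℝ) ≤ (1 + 1 / 20000) ^ 20000 :=
    le_trans (by norm_num) (one_add_mul_le_pow (show (-2 : ℝ) ≤ 1 / 20000 by norm_num) 20000)
  rw [pow_mul, ← mul_pow]
  generalize (1 + 1 / 20000 : ℝ) ^ 20000 = r at h ⊢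
  exact one_le_pow₀ (by linarith)

set_option maxHeartbeats 1000000 in
/-- The bound on cylinder intersections, with a natural number `n` in the place of `d`: on the
stable cube the three truncated marginals of `T` satisfy `triangle_lower_bound`. -/
theorem card_cylinderIntersection_ge {N : ℕ} {γ : ℝ} {D T F : Finset (Grid N)} (hγ0 : 0 < γ)
    (hD : D.Nonempty) (hps : PseudorandomLargeCubes γ D) {n k : ℕ} (hn : 1 ≤ n)
    (hk : 13000000 * n ^ 3 ≤ k) (hγ : γ ≤ (1 / 2) ^ k) (hTD : T ⊆ D)
    (hT : (1 / 2) ^ n * (D.card : ℝ) ≤ T.card) (hF : IsCylinderIntersection F) (hTF : T ⊆ F) :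
    (1 / 2) ^ k * (N : ℝ) ^ 3 ≤ F.card := by
  have hN : 0 < N := by
    obtain ⟨p, _⟩ := hD
    exact Fin.pos p.1
  have hN3 : (0 : ℝ) < (N : ℝ) ^ 3 := by positivity
  have hn2 : n ≤ n ^ 2 := by nlinarith
  have hn3 : n ^ 2 ≤ n ^ 3 := by nlinarith
  have hhalf : ∀ {i j : ℕ}, i ≤ j → (1 / 2 : ℝ) ^ j ≤ (1 / 2) ^ i := fun h =>
    pow_le_pow_of_le_one (by norm_num) (by norm_num) h
  set μ := density D with hμdef
  have hDc : (0 : ℝ) < D.card := by exact_mod_cast hD.card_pos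
  have hμ : 0 < μ := by rw [hμdef, density_eq]; positivity
  have hγ1 : γ ≤ 1 := hγ.trans (pow_le_one₀ (by norm_num) (by norm_num))
  set τ : Finset (Fin N) → Finset (Fin N) → Finset (Fin N) → ℝ := fun X Y Z =>
    (𝔼 x ∈ X, 𝔼 y ∈ Y, 𝔼 z ∈ Z, ind T (x, y, z)) / μ with hτ
  have hτ0 : ∀ X Y Z, 0 ≤ τ X Y Z := fun X Y Z => by
    refine div_nonneg ?_ hμ.le
    exact Finset.expect_nonneg fun x _ => Finset.expect_nonneg fun y _ =>
      Finset.expect_nonneg fun z _ => ind_nonneg _ _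
  have hps' : ∀ X Y Z : Finset (Fin N), γ * (N : ℝ) ^ 3 ≤ (X.card * Y.card * Z.card : ℝ) →
      PseudorandomOn γ D X Y Z := fun X Y Z h => hps X Y Z (by
    simp only [Finset.card_product]
    push_cast
    linarith)
  have hτ2 : ∀ X Y Z : Finset (Fin N), γ * (N : ℝ) ^ 3 ≤ (X.card * Y.card * Z.card : ℝ) →
      τ X Y Z ≤ 2 := by
    intro X Y Z h
    have h1 := (abs_le.1 (hps' X Y Z h).dens).2
    simp only [hτ]
    rw [div_le_iff₀ hμ]
    have h2 : 𝔼 x ∈ X, 𝔼 y ∈ Y, 𝔼 z ∈ Z, ind T (x, y, z) ≤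
        𝔼 x ∈ X, 𝔼 y ∈ Y, 𝔼 z ∈ Z, ind D (x, y, z) :=
      Finset.expect_le_expect fun x _ => Finset.expect_le_expect fun y _ =>
        Finset.expect_le_expect fun z _ => ind_mono hTD _
    nlinarith
  have hτu : (1 / 2) ^ n ≤ τ Finset.univ Finset.univ Finset.univ := by
    simp only [hτ]
    rw [← density_eq_expect, le_div_iff₀ hμ, hμdef, density_eq, density_eq, ← mul_div_assoc]
    gcongr
  -- the stable cube
  -- `m` and `η` are opaque, so that arithmetic tactics do not evaluate the large numeral powers
  obtain ⟨m, hm⟩ : ∃ m, m = 20000 * (300 * n ^ 2) := ⟨_, rfl⟩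
  obtain ⟨η, hη⟩ : ∃ η : ℝ, η = (1 / 2) ^ (300 * n ^ 2) := ⟨_, rfl⟩
  have hη0 : 0 < η := by rw [hη]; positivity
  have hm0 : m ≠ 0 := by rw [hm]; positivity
  have hηm : 1 ≤ η * (1 + 1 / 20000) ^ m := by rw [hη, hm]; exact half_pow_mul_pow_ge _
  have hsize : ((1 / 2 : ℝ) ^ n / 2) ^ m = (1 / 2) ^ ((n + 1) * m) := by
    rw [pow_mul, pow_succ]; ring
  have hm2 : (n + 1) * m ≤ 12000000 * n ^ 3 := by
    calc (n + 1) * m ≤ (2 * n) * m := by gcongr; omega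
      _ = _ := by rw [hm]; ring
  obtain ⟨X, Y, Z, hlarge, hlow, hbig, hstable⟩ := exists_stable_cube (e := 1 / 20000) (m := m)
    hN hτ0 hm0 (by norm_num) hη0 hηm (by positivity) hτu hτ2 hγ1
    (by
      rw [hsize, hη, ← pow_add]
      refine hγ.trans (hhalf ?_)
      have : 300 * n ^ 2 ≤ 1000000 * n ^ 3 := by nlinarith
      linarith)
  rw [hsize] at hbig
  have hpos : (0 : ℝ) < X.card * Y.card * Z.card := lt_of_lt_of_le (by positivity) hbig
  have hX : X.Nonempty := Finset.nonempty_iff_ne_empty.2 fun h => by simp [h] at hpos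
  have hY : Y.Nonempty := Finset.nonempty_iff_ne_empty.2 fun h => by simp [h] at hpos
  have hZ : Z.Nonempty := Finset.nonempty_iff_ne_empty.2 fun h => by simp [h] at hpos
  have hXc : (0 : ℝ) < X.card := by exact_mod_cast hX.card_pos
  have hYc : (0 : ℝ) < Y.card := by exact_mod_cast hY.card_pos
  have hZc : (0 : ℝ) < Z.card := by exact_mod_cast hZ.card_pos
  -- the truncated marginals of `T` on the stable cube
  set t := τ X Y Z with ht
  set s : ℝ := (1 / 2) ^ (n + 17) with hs
  have hs0 : 0 < s := by positivity
  have hγs : 3 * γ ≤ s ^ 2 := by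
    have h1 : γ ≤ (1 / 2) ^ ((n + 17) * 2 + 2) := hγ.trans (hhalf (by nlinarith))
    rw [pow_add, pow_mul, ← hs] at h1
    nlinarith [sq_nonneg s]
  have hst : s ≤ t / 100000 := by
    have : s = (1 / 2) ^ n * (1 / 2) ^ 17 := pow_add _ _ _
    rw [this]
    have h0 : (0 : ℝ) < (1 / 2) ^ n := by positivity
    norm_num at h0 hlow ⊢
    linarith
  set δ := t - s with hδ
  have hK : (1 + 1 / 20000) * t ≤ (1 + 1 / 10000) * δ := by rw [hδ]; linarith [hτ0 X Y Z]
  have hδlow : (1 / 2) ^ (n + 1) ≤ δ := by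
    rw [pow_succ, hδ]
    have h0 : (0 : ℝ) < (1 / 2) ^ n := by positivity
    linarith
  have hδ0 : 0 < δ := lt_of_lt_of_le (by positivity) hδlow
  have hK0 : 0 ≤ (1 + 1 / 10000) * δ := by positivity
  set a : Fin N → Fin N → ℝ := fun x y => min ((𝔼 z ∈ Z, ind T (x, y, z)) / μ) 1 with ha
  set b : Fin N → Fin N → ℝ := fun x z => min ((𝔼 y ∈ Y, ind T (x, y, z)) / μ) 1 with hb
  set c : Fin N → Fin N → ℝ := fun y z => min ((𝔼 x ∈ X, ind T (x, y, z)) / μ) 1 with hc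
  -- pseudorandomness in the three directions
  have hps1 := hps' X Y Z hlarge
  have hdz : (1 - γ) * μ ≤ 𝔼 x ∈ X, 𝔼 y ∈ Y, 𝔼 z ∈ Z, ind D (x, y, z) := by
    linarith [(abs_le.1 hps1.dens).1]
  have hdy : (1 - γ) * μ ≤ 𝔼 x ∈ X, 𝔼 z ∈ Z, 𝔼 y ∈ Y, ind D (x, y, z) := by
    simpa only [Finset.expect_comm Z Y] using hdz
  have hdx : (1 - γ) * μ ≤ 𝔼 y ∈ Y, 𝔼 z ∈ Z, 𝔼 x ∈ X, ind D (x, y, z) := by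
    rwa [expect_rotate]
  have hpz : 𝔼 x ∈ X, 𝔼 y ∈ Y, (𝔼 z ∈ Z, ind D (x, y, z)) ^ 2 ≤ (1 + γ) * μ ^ 2 := by
    simp only [pow_two (Finset.expect _ _), Finset.expect_mul_expect]
    linarith [(abs_le.1 hps1.pairs_z).2]
  have hpy : 𝔼 x ∈ X, 𝔼 z ∈ Z, (𝔼 y ∈ Y, ind D (x, y, z)) ^ 2 ≤ (1 + γ) * μ ^ 2 := by
    simp only [pow_two (Finset.expect _ _), Finset.expect_mul_expect, ← expect_rotate Y Y Z]
    linarith [(abs_le.1 hps1.pairs_y).2]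
  have hpx : 𝔼 y ∈ Y, 𝔼 z ∈ Z, (𝔼 x ∈ X, ind D (x, y, z)) ^ 2 ≤ (1 + γ) * μ ^ 2 := by
    simp only [pow_two (Finset.expect _ _), Finset.expect_mul_expect]
    simp only [← expect_rotate X X Z]
    rw [← expect_rotate X X Y]
    linarith [(abs_le.1 hps1.pairs_x).2]
  -- the densities of the marginals
  have hma : δ ≤ 𝔼 x ∈ X, 𝔼 y ∈ Y, a x y :=
    sub_le_expect_min (T := fun x y z => ind T (x, y, z)) (D := fun x y z => ind D (x, y, z))
      (fun x y z => ind_mono hTD _) hμ hs0 hγs hX hY hdz hpz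
  have hmb : δ ≤ 𝔼 x ∈ X, 𝔼 z ∈ Z, b x z := by
    refine le_trans (le_of_eq ?_) (sub_le_expect_min (T := fun x z y => ind T (x, y, z))
      (D := fun x z y => ind D (x, y, z)) (fun x y z => ind_mono hTD _) hμ hs0 hγs hX hZ hdy hpy)
    simp only [hδ, ht, hτ, Finset.expect_comm Z Y]
  have hmc : δ ≤ 𝔼 y ∈ Y, 𝔼 z ∈ Z, c y z := by
    refine le_trans (le_of_eq ?_) (sub_le_expect_min (T := fun y z x => ind T (x, y, z))
      (D := fun y z x => ind D (x, y, z)) (fun x y z => ind_mono hTD _) hμ hs0 hγs hY hZ hdx hpx)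
    rw [expect_rotate Y Z X]
  -- stability of the cube forbids dense rectangles in the marginals
  have hra : NoDenseRect X Y a ((1 + 1 / 10000) * δ) η :=
    noDenseRect_min (T := fun x y z => ind T (x, y, z)) hK0 hη0.le fun U _ V _ h => by
      refine (hstable U V Z ?_).trans hK
      linarith [mul_le_mul_of_nonneg_right h hZc.le]
  have hrb : NoDenseRect X Z b ((1 + 1 / 10000) * δ) η :=
    noDenseRect_min (T := fun x z y => ind T (x, y, z)) hK0 hη0.le fun U _ V _ h => by
      simp only [Finset.expect_comm V Y]
      refine (hstable U Y V ?_).trans hK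
      linarith [mul_le_mul_of_nonneg_right h hYc.le]
  have hrc : NoDenseRect Y Z c ((1 + 1 / 10000) * δ) η :=
    noDenseRect_min (T := fun y z x => ind T (x, y, z)) hK0 hη0.le fun U _ V _ h => by
      rw [expect_rotate U V X]
      refine (hstable X U V ?_).trans hK
      linarith [mul_le_mul_of_nonneg_right h hXc.le]
  have ha0 : ∀ x y, 0 ≤ a x y := fun x y =>
    le_min (div_nonneg (Finset.expect_nonneg fun z _ => ind_nonneg _ _) hμ.le) zero_le_one
  have hb0 : ∀ x z, 0 ≤ b x z := fun x z =>
    le_min (div_nonneg (Finset.expect_nonneg fun y _ => ind_nonneg _ _) hμ.le) zero_le_one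
  have hc0 : ∀ y z, 0 ≤ c y z := fun y z =>
    le_min (div_nonneg (Finset.expect_nonneg fun x _ => ind_nonneg _ _) hμ.le) zero_le_one
  have ha1 : ∀ x y, a x y ≤ 1 := fun x y => min_le_right _ _
  have hb1 : ∀ x z, b x z ≤ 1 := fun x z => min_le_right _ _
  have hc1 : ∀ y z, c y z ≤ 1 := fun y z => min_le_right _ _
  have hδ1 : δ ≤ 1 := hma.trans
    (Finset.expect_le hX fun x _ => Finset.expect_le hY fun y _ => ha1 x y)
  have htri := triangle_lower_bound (p := 2 * n + 2) ha0 ha1 hb0 hb1 hc0 hc1 hδ0 hδ1 hη0.le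
    hX hY hZ hra hrb hrc hma hmb hmc (by omega) ⟨n + 1, by ring⟩
    ((hhalf (by omega)).trans hδlow) (hη ▸ exponent_bound hn hδlow)
  have hle : ∀ x y z, a x y * (b x z * c y z) ≤ ind F (x, y, z) := by
    intro x y z
    by_cases hmem : (x, y, z) ∈ F
    · simp only [ind, hmem, if_true]
      exact mul_le_one₀ (ha1 _ _) (mul_nonneg (hb0 _ _) (hc0 _ _))
        (mul_le_one₀ (hb1 _ _) (hc0 _ _) (hc1 _ _))
    · simp only [ind, hmem, if_false]
      refine le_of_eq ?_
      obtain ⟨S₁, S₂, S₃, rfl⟩ := hF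
      have hS : ∀ x y z, (x, y, z) ∈ T → (x, y) ∈ S₁ ∧ (x, z) ∈ S₂ ∧ (y, z) ∈ S₃ := by
        intro x y z h
        simpa [CI] using hTF h
      by_cases h1 : (x, y) ∈ S₁
      · by_cases h2 : (x, z) ∈ S₂
        · have h3 : (y, z) ∉ S₃ := fun h3 => hmem (by simp [CI, h1, h2, h3])
          have : ∀ x', (x', y, z) ∉ T := fun x' h => h3 (hS _ _ _ h).2.2
          simp [hc, ind, this]
        · have : ∀ y', (x, y', z) ∉ T := fun y' h => h2 (hS _ _ _ h).2.1
          simp [hb, ind, this]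
      · have : ∀ z', (x, y, z') ∉ T := fun z' h => h1 (hS _ _ _ h).1
        simp [ha, ind, this]
  have hind : δ ^ 3 / 4 ≤ 𝔼 x ∈ X, 𝔼 y ∈ Y, 𝔼 z ∈ Z, ind F (x, y, z) :=
    htri.trans (Finset.expect_le_expect fun x _ => Finset.expect_le_expect fun y _ =>
      Finset.expect_le_expect fun z _ => hle x y z)
  have hδ3 : (1 / 2 : ℝ) ^ ((n + 1) * 3 + 2) ≤ δ ^ 3 / 4 := by
    have : ((1 / 2 : ℝ) ^ (n + 1)) ^ 3 ≤ δ ^ 3 := by gcongr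
    rw [pow_add, pow_mul]
    linarith
  calc (1 / 2) ^ k * (N : ℝ) ^ 3
      ≤ (1 / 2) ^ (((n + 1) * 3 + 2) + (n + 1) * m) * (N : ℝ) ^ 3 := by
        refine mul_le_mul_of_nonneg_right (hhalf ?_) hN3.le
        nlinarith
    _ = (1 / 2) ^ ((n + 1) * 3 + 2) * ((1 / 2) ^ ((n + 1) * m) * (N : ℝ) ^ 3) := by
        rw [pow_add]; ring
    _ ≤ (𝔼 x ∈ X, 𝔼 y ∈ Y, 𝔼 z ∈ Z, ind F (x, y, z)) * (X.card * Y.card * Z.card) := by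
        refine mul_le_mul (hδ3.trans hind) hbig (by positivity) ?_
        exact le_trans (by positivity) hind
    _ ≤ F.card := expect_ind_le_card F X Y Z

theorem half_pow_eq_rpow (k : ℕ) : (1 / 2 : ℝ) ^ k = (2 : ℝ) ^ (-(k : ℝ)) := by
  rw [Real.rpow_neg (by norm_num), Real.rpow_natCast, one_div, inv_pow]

theorem card_cylinderIntersection_ge_rpow {N : ℕ} {γ : ℝ} {D T F : Finset (Grid N)} (hγ0 : 0 < γ)
    (hD : D.Nonempty) (hps : PseudorandomLargeCubes γ D) {d : ℝ} (hd : 1 ≤ d)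
    (hγ : γ ≤ (2 : ℝ) ^ (-(104000000 * d ^ 3))) (hTD : T ⊆ D)
    (hT : (2 : ℝ) ^ (-d) * (D.card : ℝ) ≤ T.card) (hF : IsCylinderIntersection F) (hTF : T ⊆ F) :
    (2 : ℝ) ^ (-(104000000 * d ^ 3)) * (N : ℝ) ^ 3 ≤ F.card := by
  obtain ⟨n, hn⟩ : ∃ n, n = ⌈d⌉₊ := ⟨_, rfl⟩
  have hdn : d ≤ n := by rw [hn]; exact Nat.le_ceil d
  have hn1 : 1 ≤ n := by
    have : (1 : ℝ) ≤ n := hd.trans hdn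
    exact_mod_cast this
  have hn2 : (n : ℝ) ≤ 2 * d := by
    have := Nat.ceil_lt_add_one (show 0 ≤ d by linarith)
    rw [← hn] at this
    linarith
  obtain ⟨k, hk⟩ : ∃ k, k = 13000000 * n ^ 3 := ⟨_, rfl⟩
  have hkd : (k : ℝ) ≤ 104000000 * d ^ 3 := by
    have h : (n : ℝ) ^ 3 ≤ (2 * d) ^ 3 := by gcongr
    rw [hk]
    push_cast
    linarith
  have hpow : (2 : ℝ) ^ (-(104000000 * d ^ 3)) ≤ (1 / 2) ^ k := by
    rw [half_pow_eq_rpow]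
    exact Real.rpow_le_rpow_of_exponent_le (by norm_num) (by linarith)
  have hTn : (1 / 2 : ℝ) ^ n * (D.card : ℝ) ≤ T.card := by
    refine le_trans (mul_le_mul_of_nonneg_right ?_ (Nat.cast_nonneg _)) hT
    rw [half_pow_eq_rpow]
    exact Real.rpow_le_rpow_of_exponent_le (by norm_num) (by linarith)
  refine le_trans (mul_le_mul_of_nonneg_right hpow (by positivity))
    (card_cylinderIntersection_ge hγ0 hD hps hn1 hk.ge (hγ.trans hpow) hTD hTn hF hTF)

theorem expect_ind_eq {N : ℕ} (D F : Finset (Grid N)) :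
    𝔼 p ∈ D, ind F p = ((F ∩ D).card : ℝ) / D.card := by
  rw [Finset.expect_eq_sum_div_card, Finset.inter_comm]
  simp [ind]

end NOF

theorem mainTheorem2 :
    (∃ c t₀ : ℝ, 0 < c ∧ 0 < t₀ ∧
      ∀ (N : ℕ) (γ : ℝ) (D : Finset (NOF.Grid N)), 0 < γ → D.Nonempty →
        NOF.PseudorandomLargeCubes γ D →
        ∀ t : ℝ, t₀ ≤ t → t ≤ Real.logb 2 (1 / γ) →
        ∀ F : Finset (NOF.Grid N), NOF.IsCylinderIntersection F →
          NOF.density F ≤ (2 : ℝ) ^ (-t) →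
          (𝔼 p ∈ D, NOF.ind F p) ≤ (2 : ℝ) ^ (-(c * t ^ (1 / 3 : ℝ)))) ∧
    (∃ C₁ C₂ : ℝ, 0 < C₁ ∧ 0 < C₂ ∧
      ∀ (N : ℕ) (γ : ℝ) (D : Finset (NOF.Grid N)), 0 < γ → D.Nonempty →
        NOF.PseudorandomLargeCubes γ D →
        ∀ d : ℝ, 1 ≤ d → γ ≤ (2 : ℝ) ^ (-(C₁ * d ^ 3)) →
        ∀ T : Finset (NOF.Grid N), T ⊆ D → (2 : ℝ) ^ (-d) * (D.card : ℝ) ≤ (T.card : ℝ) →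
          (2 : ℝ) ^ (-(C₂ * d ^ 3)) * (N : ℝ) ^ 3 ≤ ((NOF.ciClosure T).card : ℝ)) := by
  refine ⟨?_, 104000000, 104000000, by norm_num, by norm_num, ?_⟩
  -- with `d = c * t ^ (1 / 3)` this `c` gives `t = 10 ^ 9 * d ^ 3`, beyond the constant of the
  -- second part
  · refine ⟨1 / 1000, 1000 ^ 3, by norm_num, by norm_num, ?_⟩
    intro N γ D hγ0 hD hps t ht htγ F hF hFd
    have ht0 : 0 < t := lt_of_lt_of_le (by norm_num) ht
    set d : ℝ := 1 / 1000 * t ^ (1 / 3 : ℝ) with hd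
    have hcube : (t ^ (1 / 3 : ℝ)) ^ 3 = t := by
      rw [← Real.rpow_natCast, ← Real.rpow_mul ht0.le]
      norm_num
    have hdt : t = 1000000000 * d ^ 3 := by
      rw [hd, mul_pow, hcube]
      ring
    have hroot : 1000 ≤ t ^ (1 / 3 : ℝ) := by
      refine le_of_pow_le_pow_left₀ (n := 3) (by norm_num) (by positivity) ?_
      rwa [hcube]
    have hd1 : 1 ≤ d := by rw [hd]; linarith
    have hd3 : 0 < d ^ 3 := by positivity
    have hlt : (2 : ℝ) ^ (-t) < (2 : ℝ) ^ (-(104000000 * d ^ 3)) :=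
      Real.rpow_lt_rpow_of_exponent_lt (by norm_num) (by linarith)
    have hγt : γ ≤ (2 : ℝ) ^ (-t) := by
      have h := (Real.le_logb_iff_rpow_le (by norm_num) (by positivity)).1 htγ
      rw [Real.rpow_neg (by norm_num), ← one_div]
      rwa [le_one_div (by positivity) hγ0] at h
    by_contra! hcon
    have hDc : (0 : ℝ) < D.card := by exact_mod_cast hD.card_pos
    rw [NOF.expect_ind_eq, lt_div_iff₀ hDc] at hcon
    have hN : 0 < N := by
      obtain ⟨p, _⟩ := hD
      exact Fin.pos p.1
    have hmain := NOF.card_cylinderIntersection_ge_rpow hγ0 hD hps hd1 (hγt.trans hlt.le)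
      Finset.inter_subset_right hcon.le hF Finset.inter_subset_left
    have hN3 : (0 : ℝ) < (N : ℝ) ^ 3 := by positivity
    rw [NOF.density_eq, div_le_iff₀ hN3] at hFd
    have := mul_lt_mul_of_pos_right hlt hN3
    linarith
  · intro N γ D hγ0 hD hps d hd hγ T hTD hT
    have h := NOF.ciClosure_isLeast T
    exact NOF.card_cylinderIntersection_ge_rpow hγ0 hD hps hd hγ hTD hT h.1.1 h.1.2
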